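/- **Setting.** For $N\ge 1$, functions on $\mathbb Z_N=\mathbb Z/N\mathbb Z$ are real valued, $\mathbb E$ denotes an average with respect to the uniform probability measure, $\langle f;g\rangle=\mathbb E_{x\in\mathbb Z_N}f(x)g(x)$, $\|f\|_1=\mathbb E_x|f(x)|$ and $\|f\|_\infty=\max_x|f(x)|$. The Gowers norms are defined by $\|f\|_{U(1)}=|\mathbb E_xf(x)|$ and, for $d\ge2$, $\|f\|_{U(d)}=\bigl(\mathbb E_t\|f\cdot f_t\|_{U(d-1)}^{2^{d-1}}\bigr)^{1/2^d}$, where $f_t(x)=f(x+t)$. The dual norm is $\|g\|_{U(d)}^*=\sup\{|\langle g;f\rangle|:\|f\|_{U(d)}\le1\}\in[0,\infty]$, and the dual function is $$\mathcal D_df(x)=\mathbb E_{t\in\mathbb Z_N^d}\prod_{\epsilon\in\{0,1\}^d\setminus\{0\}}f(x+\epsilon_1t_1+\dots+\epsilon_dt_d).$$ An $s$-step nilmanifold is a quotient $X=G/\Gamma$, where $G$ is a Lie group that is nilpotent of step at most $s$ and $\Gamma$ is a discrete cocompact subgroup. $G$ acts on $X$ by left translations. Here each nilmanifold is equipped with a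 smooth Riemannian metric. A family $\mathcal F$ consists of a set $\mathcal F_N$ of functions on $\mathbb Z_N$ for every $N\ge1$. It is called a family of $s$-step nilsequences of bounded complexity if there are a finite collection $\mathcal M$ of $s$-step nilmanifolds and a constant $M$ (both independent of $N$) such that for every $N$ every element of $\mathcal F_N$ has the form $n\mapsto F(g^n\cdot x)$, $0\le n<N$, for some $X=G/\Gamma\in\mathcal M$, $g\in G$, $x\in X$ and some $F\colon X\to\mathbb R$ with $|F|\le M$ that is Lipschitz with constant $M$ for the Riemannian distance. **Theorem.** For every integer $d\ge1$ the following three statements are equivalent. 1. *(Inverse Theorem)* For every $\delta>0$ there exist a family $\mathcal F=\mathcal F(d,\delta)$ of $(d-1)$-step nilsequences of bounded complexity and a constant $C=C(d,\delta)>0$ such that for every $N\ge1$ and every function $f$ on $\mathbb Z_N$ with $|f|\le1$ and $\|f\|_{U(d)}\ge\delta$ there exists $g\in\mathcal F_N$ with $\langle g;f\rangle\ge C$. 2. *(Dual Form)* For every $\delta>0$ there exists a family of $(d-1)$-step nilsequences of bounded complexity, with convex hull $\mathcal F'=\mathcal F'(d,\delta)$ (taken for each $N$ separately), such that for every $N\ge1$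 every function $g$ on $\mathbb Z_N$ with $\|g\|_{U(d)}^*\le1$ can be written as $g=h+\psi$ with $h\in\mathcal F'_N$ and $\|\psi\|_1\le\delta$. 3. *(Reformulated Version)* For every $\delta>0$ there exists a family of $(d-1)$-step nilsequences of bounded complexity, with convex hull $\mathcal F''=\mathcal F''(d,\delta)$, such that for every $N\ge1$ and every function $\phi$ on $\mathbb Z_N$ with $\|\phi\|_\infty\le1$ the dual function can be written as $\mathcal D_d\phi=g+h$ with $g\in\mathcal F''_N$ and $\|h\|_1\le\delta$. -/

import Mathlib

open scoped BigOperators Manifold ContDiff NNReal ENNReal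

noncomputable section

namespace GowersDual

/-! ### Gowers norms, dual functions and dual norms on a finite abelian group

The Haar measure of a finite abelian group `Z` is the uniform probability measure, so integrals are
the averages `𝔼 x, f x`. -/

section Gowers

variable {Z : Type} [AddCommGroup Z] [Fintype Z]

/-- The pairing `⟨f ; g⟩ = 𝔼_x f(x) g(x)`. -/
def pairing (f g : Z → ℝ) : ℝ := 𝔼 x, f x * g x

/-- The `L¹` norm with respect to the uniform probability measure. -/
def normOne (f : Z → ℝ) : ℝ := 𝔼 x, |f x|

/-- The Gowers uniformity norm `‖f‖_{U(d)}` for `d ≥ 1`, defined inductively by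
`‖f‖_{U(1)} = |𝔼_x f(x)|` and
`‖f‖_{U(d)} = (𝔼_t ‖f · f_t‖_{U(d-1)} ^ (2 ^ (d-1))) ^ (1 / 2 ^ d)` where `f_t(x) = f(x + t)`.
(The value at `d = 0` is not used.) -/
def gowersNorm : ℕ → (Z → ℝ) → ℝ
  | 0, _ => 0
  | 1, f => |𝔼 x, f x|
  | d + 2, f =>
    (𝔼 t : Z, gowersNorm (d + 1) (fun x => f x * f (x + t)) ^ (2 ^ (d + 1))) ^
      ((1 : ℝ) / 2 ^ (d + 2))

/-- The dual norm `‖g‖*_{U(d)} = sup {|⟨g ; f⟩| : ‖f‖_{U(d)} ≤ 1}`, with values in `[0, ∞]`. -/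
def dualNorm (d : ℕ) (g : Z → ℝ) : ℝ≥0∞ :=
  ⨆ (f : Z → ℝ) (_ : gowersNorm d f ≤ 1), ENNReal.ofReal |pairing g f|

/-- The dual function
`D_d f (x) = 𝔼_{t ∈ Z^d} ∏_{ε ∈ {0,1}^d, ε ≠ 0} f (x + ε₁ t₁ + ⋯ + ε_d t_d)`. -/
def dualFunction (d : ℕ) (f : Z → ℝ) (x : Z) : ℝ :=
  𝔼 t : Fin d → Z, ∏ ε ∈ (Finset.univ : Finset (Fin d → Fin 2)).erase 0,
    f (x + ∑ i, (ε i : ℕ) • t i)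

end Gowers

/-! ### Nilmanifolds and nilsequences of bounded complexity -/

/-- An `s`-step nilmanifold `X = G / Γ` equipped with a smooth Riemannian metric: `G` is a Lie group
which is nilpotent of step at most `s`, and `Γ` is a discrete cocompact subgroup. As `G → G / Γ` is
a covering, a smooth Riemannian metric on `G / Γ` is the same thing as a smooth Riemannian metric
on `G` which is invariant under the right translations by the elements of `Γ`, and it is given in
this form. -/
structure Nilmanifold (s : ℕ) where
  /-- the dimension -/
  dim : ℕ
  /-- the Lie group -/
  G : Type
  [group : Group G]
  [topology : TopologicalSpace G]
  [charted : ChartedSpace (EuclideanSpace ℝ (Fin dim)) G]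
  [lieGroup : LieGroup (𝓡 dim) ∞ G]
  [t2 : T2Space G]
  [secondCountable : SecondCountableTopology G]
  /-- the discrete cocompact subgroup -/
  Γ : Subgroup G
  nilpotent : (⊤ : Subgroup G).lowerCentralSeries s = ⊥
  discrete : DiscreteTopology Γ
  cocompact : CompactSpace (G ⧸ Γ)
  /-- the Riemannian metric, lifted to `G` -/
  metric : Bundle.ContMDiffRiemannianMetric (𝓡 dim) ∞ (EuclideanSpace ℝ (Fin dim))
    (fun x : G => TangentSpace (𝓡 dim) x)
  metric_invariant : ∀ γ ∈ Γ, ∀ (x : G) (v w : TangentSpace (𝓡 dim) x),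
    metric.inner (x * γ) (mfderiv (𝓡 dim) (𝓡 dim) (fun y : G => y * γ) x v)
      (mfderiv (𝓡 dim) (𝓡 dim) (fun y : G => y * γ) x w) = metric.inner x v w

namespace Nilmanifold

attribute [instance] group topology charted lieGroup t2 secondCountable discrete cocompact

variable {s : ℕ} (X : Nilmanifold s)

/-- The underlying compact space `G / Γ`, on which `G` acts by left translations. -/
abbrev Space : Type := X.G ⧸ X.Γ

open scoped Bundle in
/-- The Riemannian distance (infimum of the lengths of `C¹` paths) between two points of `G`,
for the lifted metric. -/
def liftedDist (x y : X.G) : ℝ≥0∞ :=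
  letI : Bundle.RiemannianBundle (fun x : X.G => TangentSpace (𝓡 X.dim) x) :=
    ⟨X.metric.toRiemannianMetric⟩
  Manifold.riemannianEDist (𝓡 X.dim) x y

/-- The Riemannian distance on `G / Γ`: the infimum of the distances between lifts
(`∞` if the points lie in different connected components). -/
def dist (p q : X.Space) : ℝ≥0∞ :=
  ⨅ (x : X.G) (y : X.G) (_ : (x : X.Space) = p) (_ : (y : X.Space) = q), X.liftedDist x y

/-- `F : G / Γ → ℝ` is bounded by `M` and Lipschitz with constant `M`. -/
def IsLipschitzBounded (M : ℝ≥0) (F : X.Space → ℝ) : Prop :=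
  (∀ p, |F p| ≤ M) ∧ ∀ p q, edist (F p) (F q) ≤ M * X.dist p q

end Nilmanifold

/-- The functions `n ↦ F (g ^ n • x)`, `0 ≤ n < N`, on `ℤ / Nℤ`, for `X = G / Γ` in the collection
`𝓜`, `g ∈ G`, `x ∈ X` and `F : X → ℝ` which is bounded by `M` and Lipschitz with constant `M`. -/
def nilsequences {s : ℕ} (𝓜 : Set (Nilmanifold s)) (M : ℝ≥0) (N : ℕ) : Set (ZMod N → ℝ) :=
  {φ | ∃ X ∈ 𝓜, ∃ (g : X.G) (x : X.Space) (F : X.Space → ℝ),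
    X.IsLipschitzBounded M F ∧ ∀ n : ZMod N, φ n = F (g ^ n.val • x)}

/-- A family `𝓕`, consisting of a set `𝓕 N` of functions on `ℤ / Nℤ` for each `N ≥ 1`, is a family
of `s`-step nilsequences of bounded complexity if its members come from a finite collection of
`s`-step nilmanifolds and from functions with a common bound for their sup norms and Lipschitz
constants. Both are independent of `N`. -/
def IsBoundedComplexity (s : ℕ) (𝓕 : (N : ℕ) → Set (ZMod N → ℝ)) : Prop :=
  ∃ 𝓜 : Set (Nilmanifold s), 𝓜.Finite ∧ ∃ M : ℝ≥0, ∀ N : ℕ, 1 ≤ N → 𝓕 N ⊆ nilsequences 𝓜 M N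

/-! ### The three statements -/

/-- The Inverse Theorem for the norm `U(d)`. -/
def InverseTheorem (d : ℕ) : Prop :=
  ∀ δ : ℝ, 0 < δ → ∃ 𝓕 : (N : ℕ) → Set (ZMod N → ℝ), IsBoundedComplexity (d - 1) 𝓕 ∧
    ∃ C : ℝ, 0 < C ∧ ∀ (N : ℕ) [NeZero N] (f : ZMod N → ℝ),
      (∀ x, |f x| ≤ 1) → δ ≤ gowersNorm d f → ∃ g ∈ 𝓕 N, C ≤ pairing g f

/-- The Dual Form of the Inverse Theorem. -/
def DualForm (d : ℕ) : Prop :=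
  ∀ δ : ℝ, 0 < δ → ∃ 𝓕 : (N : ℕ) → Set (ZMod N → ℝ), IsBoundedComplexity (d - 1) 𝓕 ∧
    ∀ (N : ℕ) [NeZero N] (g : ZMod N → ℝ), dualNorm d g ≤ 1 →
      ∃ h ψ : ZMod N → ℝ, g = h + ψ ∧ h ∈ convexHull ℝ (𝓕 N) ∧ normOne ψ ≤ δ

/-- The Reformulated Version of the Inverse Theorem. -/
def ReformulatedVersion (d : ℕ) : Prop :=
  ∀ δ : ℝ, 0 < δ → ∃ 𝓕 : (N : ℕ) → Set (ZMod N → ℝ), IsBoundedComplexity (d - 1) 𝓕 ∧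
    ∀ (N : ℕ) [NeZero N] (φ : ZMod N → ℝ), (∀ x, |φ x| ≤ 1) →
      ∃ g h : ZMod N → ℝ, dualFunction d φ = g + h ∧ g ∈ convexHull ℝ (𝓕 N) ∧ normOne h ≤ δ

end GowersDual

end

namespace GowersDual

/-! ### Cube averages, Gowers–Cauchy–Schwarz and dual functions -/

section Cube

variable {Z : Type} [AddCommGroup Z] [Fintype Z]

/-! The equivalence is soft: duality plus two facts about dual functions, with nilsequences entering
only through scaling and the zero function. If `g` in the dual unit ball were not approximable,
Hahn–Banach (`exists_separating`) would give a bounded `f` with `pairing g f = 2` that pairs below 2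
with the whole convex hull. Duality forces `f` to have Gowers norm above 1, so the Inverse Theorem
applied to a multiple of `f` yields a nilsequence correlating too well with `f`. The Dual Form gives
the Reformulated Version because dual functions of functions bounded by 1 lie in the dual unit ball
(`dualNorm_dualFunction_le_one`, from Gowers–Cauchy–Schwarz). The circle closes since `f` pairs with
its own dual function to `‖f‖ ^ 2 ^ d` (`pairing_dualFunction_self`): the small `L¹` error loses at
most half of this, and some point of the generating family does as well as the convex combination.
-/

lemma pow_expect_le {ι : Type*} [Fintype ι] [Nonempty ι] (a : ι → ℝ) (ha : ∀ i, 0 ≤ a i) (n : ℕ) :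
    (𝔼 i, a i) ^ n ≤ 𝔼 i, a i ^ n := by
  have h := Real.pow_arith_mean_le_arith_mean_pow Finset.univ
    (fun _ : ι => (Fintype.card ι : ℝ)⁻¹) a (fun _ _ => by positivity) (by simp) (fun i _ => ha i) n
  simpa only [Fintype.expect_eq_sum_div_card, ← Finset.mul_sum, div_eq_inv_mul] using h

lemma expect_shift (f : Z → ℝ) (x : Z) : 𝔼 u, f (x + u) = 𝔼 u, f u :=
  Fintype.expect_equiv (Equiv.addLeft x) _ _ fun _ => rfl

/-- The average of the values of a family of functions over the vertices of a parallelepiped. -/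
noncomputable def cubeAverage (d : ℕ) (F : (Fin d → Fin 2) → Z → ℝ) : ℝ :=
  𝔼 x, 𝔼 t : Fin d → Z, ∏ ε, F ε (x + ∑ i, (ε i : ℕ) • t i)

/-- The average over the parallelepipeds with fixed directions `t`. -/
noncomputable def faceAverage (d : ℕ) (F : (Fin d → Fin 2) → Z → ℝ) (t : Fin d → Z) : ℝ :=
  𝔼 x, ∏ ε, F ε (x + ∑ i, (ε i : ℕ) • t i)

lemma expect_face_mul_face (d : ℕ) (F H : (Fin d → Fin 2) → Z → ℝ) (t : Fin d → Z) :
    𝔼 u, 𝔼 x, (∏ ε, F ε (x + ∑ i, (ε i : ℕ) • t i)) *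
      ∏ ε, H ε (x + u + ∑ i, (ε i : ℕ) • t i) = faceAverage d F t * faceAverage d H t := by
  rw [Finset.expect_comm]
  simp_rw [← Finset.mul_expect, expect_shift fun y => ∏ ε, H ε (y + ∑ i, (ε i : ℕ) • t i)]
  rw [← Finset.expect_mul]
  rfl

/-- The first direction `u` moves one face of the cube onto the opposite one. Once the other
directions `t` are fixed, the base points `x` and `x + u` of the two faces are independent. -/
lemma cubeAverage_succ (d : ℕ) (F : (Fin (d + 1) → Fin 2) → Z → ℝ) :
    cubeAverage (d + 1) F = 𝔼 t, faceAverage d (fun ε => F (Fin.cons 0 ε)) t *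
      faceAverage d (fun ε => F (Fin.cons 1 ε)) t := by
  simp_rw [← expect_face_mul_face]
  rw [cubeAverage, Finset.expect_comm]
  rw [← Fintype.expect_equiv (Fin.consEquiv fun _ => Z) (fun p => 𝔼 x,
    ∏ ε : Fin (d + 1) → Fin 2, F ε (x + ∑ i, (ε i : ℕ) • (Fin.cons p.1 p.2 : Fin (d + 1) → Z) i))
    _ fun p => rfl, ← Finset.univ_product_univ, Finset.expect_product, Finset.expect_comm]
  refine Finset.expect_congr rfl fun t _ => Finset.expect_congr rfl fun u _ =>
    Finset.expect_congr rfl fun x _ => ?_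
  rw [← Fintype.prod_equiv (Fin.consEquiv fun _ => Fin 2) (fun p => F (Fin.cons p.1 p.2)
    (x + ∑ i, ((Fin.cons p.1 p.2 : Fin (d + 1) → Fin 2) i : ℕ) •
      (Fin.cons u t : Fin (d + 1) → Z) i)) _ fun p => rfl,
    ← Finset.univ_product_univ, Finset.prod_product, Fin.prod_univ_two]
  simp [Fin.sum_univ_succ, add_assoc]

/-- Squaring produces two copies of a face with independent base points `x` and `x + u`; grouping
corresponding vertices turns them into one cube of multiplicative derivatives. This is the inductive
step behind both the cube formula for the norm and Gowers–Cauchy–Schwarz. -/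
lemma expect_faceAverage_sq (d : ℕ) (F : (Fin d → Fin 2) → Z → ℝ) :
    𝔼 t, faceAverage d F t ^ 2 = 𝔼 u, cubeAverage d fun ε x => F ε x * F ε (x + u) := by
  simp_rw [sq, ← expect_face_mul_face]
  rw [Finset.expect_comm]
  refine Finset.expect_congr rfl fun u _ => ?_
  rw [cubeAverage, Finset.expect_comm]
  simp only [Finset.prod_mul_distrib, add_right_comm]

lemma abs_prod_le_one {ι : Type*} (s : Finset ι) (f : ι → ℝ) (hf : ∀ i ∈ s, |f i| ≤ 1) :
    |∏ i ∈ s, f i| ≤ 1 := by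
  rw [Finset.abs_prod]
  exact Finset.prod_le_one (fun _ _ => abs_nonneg _) hf

lemma abs_expect_le_one {ι : Type*} [Fintype ι] [Nonempty ι] (f : ι → ℝ) (hf : ∀ i, |f i| ≤ 1) :
    |𝔼 i, f i| ≤ 1 :=
  (Finset.abs_expect_le _ _).trans (Finset.expect_le Finset.univ_nonempty fun i _ => hf i)

lemma abs_faceAverage_le_one (d : ℕ) (F : (Fin d → Fin 2) → Z → ℝ) (hF : ∀ ε x, |F ε x| ≤ 1)
    (t : Fin d → Z) : |faceAverage d F t| ≤ 1 :=
  abs_expect_le_one _ fun _ => abs_prod_le_one _ _ fun _ _ => hF _ _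

lemma gowersNorm_nonneg (d : ℕ) (f : Z → ℝ) : 0 ≤ gowersNorm d f := by
  match d with
  | 0 => exact le_rfl
  | 1 => exact abs_nonneg _
  | d + 2 =>
    rw [gowersNorm]
    exact Real.rpow_nonneg (Finset.expect_nonneg fun t _ =>
      (even_two.pow_of_ne_zero (by simp)).pow_nonneg _) _

lemma gowersNorm_pow (d : ℕ) (f : Z → ℝ) :
    gowersNorm (d + 2) f ^ 2 ^ (d + 2) =
      𝔼 t, gowersNorm (d + 1) (fun x => f x * f (x + t)) ^ 2 ^ (d + 1) := by
  have h := Real.rpow_inv_natCast_pow (n := 2 ^ (d + 2))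
    (Finset.expect_nonneg fun (t : Z) (_ : t ∈ Finset.univ) =>
      pow_nonneg (gowersNorm_nonneg (d + 1) fun x => f x * f (x + t)) (2 ^ (d + 1))) (by simp)
  rw [← h, gowersNorm]
  simp

lemma gowersNorm_const_one (d : ℕ) (hd : 1 ≤ d) : gowersNorm d (fun _ : Z => (1 : ℝ)) = 1 := by
  induction d, hd using Nat.le_induction with
  | base => simp [gowersNorm]
  | succ d hd ih =>
    obtain ⟨d, rfl⟩ := Nat.exists_eq_add_of_le' hd
    simp [gowersNorm, ih]

lemma gowersNorm_smul (d : ℕ) (c : ℝ) (f : Z → ℝ) :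
    gowersNorm d (c • f) = |c| * gowersNorm d f := by
  cases d with
  | zero => simp [gowersNorm]
  | succ d =>
    induction d generalizing c f with
    | zero => simp [gowersNorm, ← Finset.mul_expect, abs_mul]
    | succ d ih =>
      refine (pow_left_inj₀ (gowersNorm_nonneg _ _)
        (mul_nonneg (abs_nonneg _) (gowersNorm_nonneg _ _)) (n := 2 ^ (d + 2)) (by simp)).1 ?_
      have key : ∀ t, gowersNorm (d + 1) (fun x => (c • f) x * (c • f) (x + t)) =
          c ^ 2 * gowersNorm (d + 1) (fun x => f x * f (x + t)) := fun t => by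
        rw [← abs_of_nonneg (sq_nonneg c), ← ih]
        congr 1
        ext x
        simp only [Pi.smul_apply, smul_eq_mul]
        ring
      rw [gowersNorm_pow, mul_pow, gowersNorm_pow]
      simp_rw [key, mul_pow, ← Finset.mul_expect]
      rw [← sq_abs, ← pow_mul, ← pow_succ' 2 (d + 1)]

lemma cubeAverage_const (d : ℕ) (f : Z → ℝ) :
    cubeAverage (d + 1) (fun _ => f) = gowersNorm (d + 1) f ^ 2 ^ (d + 1) := by
  induction d generalizing f with
  | zero =>
    rw [cubeAverage_succ]
    simp [faceAverage, gowersNorm, sq]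
  | succ d ih =>
    rw [cubeAverage_succ, gowersNorm_pow]
    simp_rw [← sq, ← ih]
    exact expect_faceAverage_sq (d + 1) fun _ => f

/-- The Gowers-Cauchy-Schwarz inequality for a cube all of whose functions except the one at the
origin are bounded by `1`. -/
lemma abs_cubeAverage_le (d : ℕ) (F : (Fin (d + 1) → Fin 2) → Z → ℝ)
    (hF : ∀ ε, ε ≠ 0 → ∀ x, |F ε x| ≤ 1) :
    |cubeAverage (d + 1) F| ≤ gowersNorm (d + 1) (F 0) := by
  -- The face with first coordinate 1 misses the origin, so all its functions are bounded by 1.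
  have h1 : ∀ n (F : (Fin (n + 1) → Fin 2) → Z → ℝ), (∀ ε, ε ≠ 0 → ∀ x, |F ε x| ≤ 1) →
      ∀ t, |faceAverage n (fun ε => F (Fin.cons 1 ε)) t| ≤ 1 := fun n F hF t =>
    abs_faceAverage_le_one _ _ (fun ε x => hF _ (fun h => by simpa using congrFun h 0) x) t
  have h2 : ∀ n (F : (Fin (n + 1) → Fin 2) → Z → ℝ), (∀ ε, ε ≠ 0 → ∀ x, |F ε x| ≤ 1) →
      |cubeAverage (n + 1) F| ≤ 𝔼 t, |faceAverage n (fun ε => F (Fin.cons 0 ε)) t| := by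
    intro n F hF
    rw [cubeAverage_succ]
    refine (Finset.abs_expect_le _ _).trans (Finset.expect_le_expect fun t _ => ?_)
    rw [abs_mul]
    exact mul_le_of_le_one_right (abs_nonneg _) (h1 n F hF t)
  induction d with
  | zero =>
    refine (h2 0 F hF).trans (le_of_eq ?_)
    simp only [faceAverage, Finset.univ_unique, Finset.prod_singleton, Finset.univ_eq_empty,
      Finset.sum_empty, add_zero, Finset.expect_singleton, gowersNorm]
    exact congrArg (fun ε => |𝔼 x, F ε x|) (funext fun i => by fin_cases i; rfl)
  | succ d ih =>
    -- Cauchy–Schwarz in the remaining directions leaves a cube of derivatives of one lower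
    -- dimension, with `F 0` still at its origin.
    have hsq : |cubeAverage (d + 2) F| ^ 2 ≤
        𝔼 u, gowersNorm (d + 1) (fun x => F 0 x * F 0 (x + u)) := by
      calc |cubeAverage (d + 2) F| ^ 2
          ≤ (𝔼 t, |faceAverage (d + 1) (fun ε => F (Fin.cons 0 ε)) t|) ^ 2 := by
            gcongr
            exact h2 _ F hF
        _ ≤ 𝔼 t, |faceAverage (d + 1) (fun ε => F (Fin.cons 0 ε)) t| ^ 2 :=
            pow_expect_le _ (fun _ => abs_nonneg _) 2
        _ = 𝔼 u, cubeAverage (d + 1) fun ε x => F (Fin.cons 0 ε) x * F (Fin.cons 0 ε) (x + u) := by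
            simp_rw [sq_abs]
            exact expect_faceAverage_sq _ _
        _ ≤ _ := Finset.expect_le_expect fun u _ => (le_abs_self _).trans <| by
            have h0 : (Fin.cons 0 0 : Fin (d + 2) → Fin 2) = 0 := by
              ext i; refine Fin.cases ?_ (fun j => ?_) i <;> simp
            have := ih (fun ε x => F (Fin.cons 0 ε) x * F (Fin.cons 0 ε) (x + u)) fun ε hε x => by
              have hne : (Fin.cons 0 ε : Fin (d + 2) → Fin 2) ≠ 0 := fun h =>
                hε (funext fun i => by simpa using congrFun h i.succ)
              rw [abs_mul]
              exact mul_le_one₀ (hF _ hne _) (abs_nonneg _) (hF _ hne _)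
            simpa only [h0] using this
    refine le_of_pow_le_pow_left₀ (n := 2 ^ (d + 2)) (by simp) (gowersNorm_nonneg _ _) ?_
    rw [gowersNorm_pow, pow_succ' 2 (d + 1), pow_mul]
    exact (pow_le_pow_left₀ (sq_nonneg _) hsq _).trans
      (pow_expect_le _ (fun _ => gowersNorm_nonneg _ _) _)

/-- Pairing fills the vertex that the dual function omits. -/
lemma pairing_dualFunction (d : ℕ) (φ f : Z → ℝ) :
    pairing (dualFunction d φ) f = cubeAverage d fun ε => if ε = 0 then f else φ := by
  refine Finset.expect_congr rfl fun x _ => ?_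
  rw [dualFunction, Finset.expect_mul]
  refine Finset.expect_congr rfl fun t _ => ?_
  rw [← Finset.prod_erase_mul _ _ (Finset.mem_univ (0 : Fin d → Fin 2))]
  congr 1
  · refine Finset.prod_congr rfl fun ε hε => ?_
    simp only [if_neg (Finset.ne_of_mem_erase hε)]
  · simp

lemma dualNorm_dualFunction_le_one (d : ℕ) (hd : 1 ≤ d) (φ : Z → ℝ) (hφ : ∀ x, |φ x| ≤ 1) :
    dualNorm d (dualFunction d φ) ≤ 1 := by
  obtain ⟨d, rfl⟩ := Nat.exists_eq_add_of_le' hd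
  refine iSup₂_le fun f hf => ENNReal.ofReal_le_one.2 ?_
  rw [pairing_dualFunction]
  refine (abs_cubeAverage_le d _ fun ε hε x => ?_).trans (by simpa using hf)
  rw [if_neg hε]
  exact hφ x

lemma pairing_dualFunction_self (d : ℕ) (hd : 1 ≤ d) (f : Z → ℝ) :
    pairing (dualFunction d f) f = gowersNorm d f ^ 2 ^ d := by
  obtain ⟨d, rfl⟩ := Nat.exists_eq_add_of_le' hd
  rw [pairing_dualFunction]
  simp only [ite_self]
  exact cubeAverage_const d f

end Cube

/-! ### Separation of convex sets in the `L¹` norm -/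

section Separation

variable {Z : Type} [Fintype Z]

lemma pairing_add_left (g h f : Z → ℝ) : pairing (g + h) f = pairing g f + pairing h f := by
  simp [pairing, add_mul, Finset.expect_add_distrib]

lemma pairing_smul_left (c : ℝ) (g f : Z → ℝ) : pairing (c • g) f = c * pairing g f := by
  simp [pairing, mul_assoc, Finset.mul_expect]

lemma pairing_smul_right (c : ℝ) (g f : Z → ℝ) : pairing g (c • f) = c * pairing g f := by
  simp [pairing, mul_left_comm, Finset.mul_expect]

lemma pairing_single [DecidableEq Z] (x : Z) (r : ℝ) (f : Z → ℝ) :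
    pairing (Pi.single x (Fintype.card Z * r)) f = r * f x := by
  have : Nonempty Z := ⟨x⟩
  have : (Fintype.card Z : ℝ) ≠ 0 := by simp
  simp only [pairing, Fintype.expect_eq_sum_div_card, Pi.single_apply, ite_mul, zero_mul,
    Finset.sum_ite_eq', Finset.mem_univ, if_true]
  field_simp

lemma normOne_single [DecidableEq Z] (x : Z) (r : ℝ) :
    normOne (Pi.single x (Fintype.card Z * r) : Z → ℝ) = |r| := by
  have : Nonempty Z := ⟨x⟩
  have : (Fintype.card Z : ℝ) ≠ 0 := by simp
  simp only [normOne, Fintype.expect_eq_sum_div_card, Pi.single_apply, apply_ite abs, abs_zero,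
    Finset.sum_ite_eq', Finset.mem_univ, if_true, abs_mul, Nat.abs_cast]
  field_simp

lemma abs_pairing_le (h f : Z → ℝ) (hf : ∀ x, |f x| ≤ 1) : |pairing h f| ≤ normOne h :=
  (Finset.abs_expect_le _ _).trans <| Finset.expect_le_expect fun x _ => by
    rw [abs_mul]
    exact mul_le_of_le_one_right (abs_nonneg _) (hf x)

lemma exists_pairing_eq (L : (Z → ℝ) →ₗ[ℝ] ℝ) : ∃ f : Z → ℝ, ∀ g, L g = pairing g f := by
  classical
  refine ⟨fun x => Fintype.card Z * L (Pi.single x 1), fun g => ?_⟩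
  rw [L.pi_apply_eq_sum_univ g, pairing, Fintype.expect_eq_sum_div_card, Finset.sum_div]
  refine Finset.sum_congr rfl fun x _ => ?_
  have hs : (fun j => if x = j then (1 : ℝ) else 0) = Pi.single x 1 := by
    ext j; simp [Pi.single_apply, eq_comm]
  have : Nonempty Z := ⟨x⟩
  have : (Fintype.card Z : ℝ) ≠ 0 := by simp
  rw [hs, smul_eq_mul]
  field_simp

lemma convex_normOne_lt (δ : ℝ) : Convex ℝ {ψ : Z → ℝ | normOne ψ < δ} := by
  intro a ha b hb s t hs ht hst
  have h : normOne (s • a + t • b) ≤ s * normOne a + t * normOne b := by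
    rw [normOne, normOne, normOne, Finset.mul_expect, Finset.mul_expect,
      ← Finset.expect_add_distrib]
    refine Finset.expect_le_expect fun x _ => (abs_add_le _ _).trans (le_of_eq ?_)
    simp [abs_mul, abs_of_nonneg hs, abs_of_nonneg ht]
  exact h.trans_lt ((convex_Iio δ) ha hb hs ht hst)

lemma isOpen_normOne_lt (δ : ℝ) : IsOpen {ψ : Z → ℝ | normOne ψ < δ} := by
  have h : Continuous fun ψ : Z → ℝ => (∑ x, |ψ x|) / Fintype.card Z := by fun_prop
  simp_rw [← Fintype.expect_eq_sum_div_card] at h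
  exact isOpen_lt h continuous_const

open scoped Pointwise in
/-- A function which is not within `L¹` distance `δ` of a convex set containing `0` is separated
from it by a bounded function. -/
lemma exists_separating {δ : ℝ} (hδ : 0 < δ) {S : Set (Z → ℝ)} (hS : Convex ℝ S) (h0 : 0 ∈ S)
    {g : Z → ℝ} (hg : ∀ h ψ, g = h + ψ → h ∈ S → ¬ normOne ψ ≤ δ) :
    ∃ f : Z → ℝ, pairing g f = 2 ∧ (∀ x, |f x| ≤ 2 / δ) ∧ ∀ h ∈ S, pairing h f < 2 := by
  classical
  -- The strict inequality makes the sum open, as Hahn–Banach needs.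
  have hdisj : g ∉ S + {ψ : Z → ℝ | normOne ψ < δ} := by
    rintro ⟨h, hh, ψ, hψ, rfl⟩
    exact hg h ψ rfl hh (le_of_lt hψ)
  obtain ⟨L, hL⟩ := geometric_hahn_banach_open_point (hS.add (convex_normOne_lt δ))
    (isOpen_normOne_lt δ).add_left hdisj
  obtain ⟨f, hf⟩ := exists_pairing_eq (L : (Z → ℝ) →ₗ[ℝ] ℝ)
  replace hL : ∀ h ∈ S, ∀ ψ, normOne ψ < δ → pairing (h + ψ) f < pairing g f := fun h hh ψ hψ => by
    rw [← hf, ← hf]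
    exact hL _ ⟨h, hh, ψ, hψ, rfl⟩
  have hz : normOne (0 : Z → ℝ) < δ := by simpa [normOne] using hδ
  have hpos : 0 < pairing g f := by simpa [pairing] using hL 0 h0 0 hz
  -- Rescale so that `g` pairs to 2. Any value above 1 would contradict membership in the dual ball
  -- if `f` had Gowers norm at most 1.
  have hc : 0 < 2 / pairing g f := by positivity
  have key : ∀ h ∈ S, ∀ ψ, normOne ψ < δ → pairing (h + ψ) ((2 / pairing g f) • f) < 2 :=
    fun h hh ψ hψ => by
      rw [pairing_smul_right]
      calc _ < 2 / pairing g f * pairing g f := mul_lt_mul_of_pos_left (hL h hh ψ hψ) hc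
        _ = 2 := by field_simp
  generalize hf' : (2 / pairing g f) • f = f' at key
  refine ⟨f', ?_, fun x => ?_, fun h hh => by simpa using key h hh 0 hz⟩
  · rw [← hf', pairing_smul_right]
    field_simp
  -- `L¹`–`L∞` duality: where `f'` is too large, a point mass of `L¹` norm below `δ` already pairs
  -- to exactly 2.
  · by_contra! hx
    have hfx : 0 < |f' x| := lt_trans (by positivity) hx
    have hr : |2 / f' x| < δ := by
      rw [abs_div, abs_two, div_lt_iff₀ hfx]
      rwa [div_lt_iff₀ hδ, mul_comm] at hx
    have := key 0 h0 _ ((normOne_single x (2 / f' x)).trans_lt hr)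
    rw [zero_add, pairing_single, div_mul_cancel₀ _ (abs_pos.1 hfx)] at this
    exact lt_irrefl _ this

/-- Otherwise `S`, and hence its convex hull, would lie in an open half-space that excludes `g`. -/
lemma exists_le_pairing_of_mem_convexHull {S : Set (Z → ℝ)} {g : Z → ℝ}
    (hg : g ∈ convexHull ℝ S) (f : Z → ℝ) : ∃ h ∈ S, pairing g f ≤ pairing h f := by
  by_contra! hlt
  have hconv : Convex ℝ {h : Z → ℝ | pairing h f < pairing g f} := by
    intro a ha b hb s t hs ht hst
    have := (convex_Iio (pairing g f)) ha hb hs ht hst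
    simpa [pairing_add_left, pairing_smul_left] using this
  exact lt_irrefl (pairing g f) (convexHull_min hlt hconv hg)

end Separation

/-! ### Scaling nilsequences, and the three implications -/

lemma Nilmanifold.IsLipschitzBounded.smul {s : ℕ} {X : Nilmanifold s} {M : ℝ≥0}
    {F : X.Space → ℝ} (hF : X.IsLipschitzBounded M F) (c : ℝ≥0) :
    X.IsLipschitzBounded (c * M) fun p => c * F p := by
  refine ⟨fun p => ?_, fun p q => ?_⟩
  · rw [abs_mul, NNReal.abs_eq, NNReal.coe_mul]
    exact mul_le_mul_of_nonneg_left (hF.1 p) c.2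
  · have h : edist ((c : ℝ) * F p) (c * F q) = c * edist (F p) (F q) := by
      have := edist_smul₀ (c : ℝ) (F p) (F q)
      simpa [ENNReal.smul_def] using this
    rw [h, ENNReal.coe_mul, mul_assoc]
    exact mul_le_mul_right (hF.2 p q) _

lemma smul_mem_nilsequences {s : ℕ} {𝓜 : Set (Nilmanifold s)} {M : ℝ≥0} {N : ℕ}
    {φ : ZMod N → ℝ} (hφ : φ ∈ nilsequences 𝓜 M N) (c : ℝ≥0) :
    (c : ℝ) • φ ∈ nilsequences 𝓜 (c * M) N := by
  obtain ⟨X, hX, g, x, F, hF, h⟩ := hφ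
  exact ⟨X, hX, g, x, _, hF.smul c, fun n => by simp [h]⟩

lemma zero_mem_nilsequences {s : ℕ} {𝓜 : Set (Nilmanifold s)} {M M' : ℝ≥0} {N : ℕ}
    {φ : ZMod N → ℝ} (hφ : φ ∈ nilsequences 𝓜 M N) : 0 ∈ nilsequences 𝓜 M' N := by
  obtain ⟨X, hX, g, x, -⟩ := hφ
  exact ⟨X, hX, g, x, fun _ => 0, ⟨by simp, by simp⟩, fun n => rfl⟩

theorem InverseTheorem.dualForm {d : ℕ} (hd : 1 ≤ d) (H : InverseTheorem d) : DualForm d := by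
  intro δ hδ
  -- The bound 1 lets the constant function 1 satisfy the hypothesis even for large `δ`; this shows
  -- that the family is nonempty, so 0 is a nilsequence too.
  obtain ⟨𝓕, ⟨𝓜, h𝓜, M, h𝓕⟩, C, hC, hinv⟩ := H (min (δ / 2) 1) (by positivity)
  obtain ⟨c, hc⟩ : ∃ c : ℝ≥0, (c : ℝ) = δ / C := ⟨⟨δ / C, by positivity⟩, rfl⟩
  -- All nilsequences of this complexity are taken, so that the family contains both 0 and `c • 𝓕
  -- N`. The factor `c = δ / C` turns correlation `C` with `(δ / 2) • f` into a pairing of at least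
  -- 2 with `f`.
  refine ⟨fun N => nilsequences 𝓜 (c * M) N, ⟨𝓜, h𝓜, _, fun N _ => subset_rfl⟩, ?_⟩
  intro N _ g hg
  by_contra! hne
  have h0 : (0 : ZMod N → ℝ) ∈ nilsequences 𝓜 (c * M) N := by
    obtain ⟨φ, hφ, -⟩ := hinv N (fun _ => 1) (by simp) (by simp [gowersNorm_const_one d hd])
    exact zero_mem_nilsequences (h𝓕 N NeZero.one_le hφ)
  obtain ⟨f, hgf, hf, hlt⟩ := exists_separating hδ (convex_convexHull ℝ _)
    (subset_convexHull ℝ _ h0) fun h ψ e hh => not_le.2 (hne h ψ e hh)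
  have hnorm : 1 < gowersNorm d f := by
    by_contra! hle
    have := (le_iSup₂ (f := fun (f : ZMod N → ℝ) (_ : gowersNorm d f ≤ 1) =>
      ENNReal.ofReal |pairing g f|) f hle).trans hg
    rw [ENNReal.ofReal_le_one, hgf] at this
    norm_num at this
  have hδ2 : |δ / 2| = δ / 2 := abs_of_pos (by positivity)
  obtain ⟨φ, hφ, hCφ⟩ := hinv N ((δ / 2) • f) (fun x => by
      rw [Pi.smul_apply, smul_eq_mul, abs_mul, hδ2]
      calc δ / 2 * |f x| ≤ δ / 2 * (2 / δ) := by gcongr; exact hf x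
        _ = 1 := by field_simp)
    (by
      rw [gowersNorm_smul, hδ2]
      exact (min_le_left _ _).trans (le_mul_of_one_le_right (by positivity) hnorm.le))
  have hlt' := hlt _ (subset_convexHull ℝ _ (smul_mem_nilsequences (h𝓕 N NeZero.one_le hφ) c))
  rw [pairing_smul_right] at hCφ
  rw [pairing_smul_left, hc, div_mul_eq_mul_div, div_lt_iff₀ hC] at hlt'
  linarith

theorem DualForm.reformulatedVersion {d : ℕ} (hd : 1 ≤ d) (H : DualForm d) :
    ReformulatedVersion d := by
  intro δ hδ
  obtain ⟨𝓕, h𝓕, h⟩ := H δ hδ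
  exact ⟨𝓕, h𝓕, fun N _ φ hφ => h N _ (dualNorm_dualFunction_le_one d hd φ hφ)⟩

theorem ReformulatedVersion.inverseTheorem {d : ℕ} (hd : 1 ≤ d) (H : ReformulatedVersion d) :
    InverseTheorem d := by
  intro δ hδ
  -- Half of the lower bound for the self-pairing is spent on the `L¹` error; the other half is the
  -- correlation obtained.
  obtain ⟨𝓕, h𝓕, h⟩ := H (δ ^ 2 ^ d / 2) (by positivity)
  refine ⟨𝓕, h𝓕, δ ^ 2 ^ d / 2, by positivity, fun N _ f hf hfδ => ?_⟩
  obtain ⟨g, r, hgr, hg, hr⟩ := h N f hf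
  obtain ⟨φ, hφ, hle⟩ := exists_le_pairing_of_mem_convexHull hg f
  refine ⟨φ, hφ, le_trans ?_ hle⟩
  have h1 := pairing_dualFunction_self d hd f
  have h2 := (le_abs_self _).trans ((abs_pairing_le r f hf).trans hr)
  have h3 : δ ^ 2 ^ d ≤ gowersNorm d f ^ 2 ^ d := pow_le_pow_left₀ hδ.le hfδ _
  rw [hgr, pairing_add_left] at h1
  linarith

end GowersDual

/-- For each `d ≥ 1`, the Inverse Theorem for the Gowers norm `U(d)`, its Dual Form and its
Reformulated Version are equivalent. -/
theorem mainTheorem11 (d : ℕ) (hd : 1 ≤ d) :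
    (GowersDual.InverseTheorem d ↔ GowersDual.DualForm d) ∧
      (GowersDual.InverseTheorem d ↔ GowersDual.ReformulatedVersion d) :=
  ⟨⟨fun h => h.dualForm hd, fun h => (h.reformulatedVersion hd).inverseTheorem hd⟩,
    ⟨fun h => (h.dualForm hd).reformulatedVersion hd, fun h => h.inverseTheorem hd⟩⟩
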